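/- Let $V$ be a real inner product space of finite dimension with inner product $(\cdot,\cdot)$, and let $\mathrm{Vol}$ be its Lebesgue measure. Let $E\subset V$ be a finite set of unit vectors, no two of them linearly dependent, such that $T_0=\{x\in V:(e,x)>0 \text{ for all } e\in E\}$ is nonempty. Let $\mathcal H=\{H_e: e\in E\}$, where $H_e=\{x\in V:(e,x)=0\}$, be the corresponding hyperplane arrangement with base chamber $T_0$, and write $|\mathcal H|=|E|$. The chambers of $\mathcal H$ are the connected components of $V\setminus\bigcup_{e\in E}H_e$. For a chamber $T$ let $(-1)^T=(-1)^{s}$, where $s$ is the number of $e\in E$ such that $T_0$ and $T$ lie on different sides of $H_e$. For a measurable set $K\subseteq V$ of finite volume, the pizza quantity is $$P(\mathcal H,K)=\sum_{T}(-1)^T\,\mathrm{Vol}(K\cap T),$$ where $T$ runs over the chambers of $\mathcal H$. Suppose that $\mathcal H$ satisfies the parity condition, that is, $|\mathcal H|\equiv\dim V \pmod 2$. Let $q$ be a positive definite quadratic form on $V$, and write $\mathbb B_q(a,R)=\{x\in V: q(x-a)\le R^2\}$ for $a\in V$ and $R\in\mathbb R$. Let $E'\subseteq E$ be such that the subarrangement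 $\mathcal H'=\{H_e:e\in E'\}$ is a Coxeter arrangement, that is, the group $W$ generated by the orthogonal reflections in the hyperplanes of $\mathcal H'$ is finite and $\mathcal H'$ is closed under these reflections. Suppose that every $w\in W$ maps $\mathcal H$ onto $\mathcal H$ and $\mathbb B_q(0,1)$ onto $\mathbb B_q(0,1)$. (i) If $|\mathcal H'|>\dim V$, then $P(\mathcal H,\mathbb B_q(a,R))=0$ for all $(R,a)\in\mathbb R\times V$ with $q(a)\le R^2$. (ii) If $|\mathcal H'|=\dim V$, then there is a constant $c\in\mathbb R$, independent of $a$ and $R$, such that $$P(\mathcal H,\mathbb B_q(a,R))=c\cdot\prod_{e\in E'}(a,e)$$ for all $(R,a)\in\mathbb R\times V$ with $q(a)\le R^2$. In particular, for fixed $a$, the quantity $P(\mathcal H,\mathbb B_q(a,R))$ does not depend on $R$ as long as $q(a)\le R^2$. -/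

import Mathlib

open scoped RealInnerProductSpace

noncomputable section

/-- A finite central hyperplane arrangement in a real inner product space, together with a base
chamber. It is given by its set `E` of unit normal vectors, all pointing to the side of the base
chamber, so that the hyperplanes are the `H_e = {x : ⟪e, x⟫ = 0}` for `e ∈ E`. -/
structure HyperplaneArrangement (V : Type*) [NormedAddCommGroup V] [InnerProductSpace ℝ V] where
  /-- The set `E` of unit normal vectors. -/
  normals : Finset V
  norm_eq_one : ∀ e ∈ normals, ‖e‖ = 1
  linearIndependent_pair : ∀ e ∈ normals, ∀ f ∈ normals, e ≠ f → LinearIndependent ℝ ![e, f]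
  /-- There is a point on the positive side of all the hyperplanes. -/
  exists_pos : ∃ x : V, ∀ e ∈ normals, 0 < ⟪e, x⟫

namespace HyperplaneArrangement

variable {V : Type*} [NormedAddCommGroup V] [InnerProductSpace ℝ V]

/-- The hyperplane `H_e` orthogonal to `e`. -/
def hyperplane (e : V) : Submodule ℝ V := (Submodule.span ℝ {e})ᗮ

/-- The set of hyperplanes of the arrangement. -/
def hyperplanes (H : HyperplaneArrangement V) : Set (Submodule ℝ V) :=
  {L | ∃ e ∈ H.normals, L = hyperplane e}

/-- The number `|H|` of hyperplanes, that is, the cardinality of the index set `E`. -/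
def card (H : HyperplaneArrangement V) : ℕ := H.normals.card

/-- The complement in `V` of the union of the hyperplanes. -/
def compl (H : HyperplaneArrangement V) : Set V :=
  {x | ∀ L ∈ H.hyperplanes, x ∉ L}

/-- The chambers: the connected components of the complement of the arrangement. -/
def chambers (H : HyperplaneArrangement V) : Set (Set V) :=
  {T | ∃ x ∈ H.compl, T = connectedComponentIn H.compl x}

/-- The open positive half-space of `e`. -/
def posHalfSpace (e : V) : Set V := {x | 0 < ⟪e, x⟫}

/-- The open negative half-space of `e`. -/
def negHalfSpace (e : V) : Set V := {x | ⟪e, x⟫ < 0}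

/-- The base chamber `T₀`: the intersection of all the positive half-spaces. -/
def baseChamber (H : HyperplaneArrangement V) : Set V :=
  {x | ∀ e ∈ H.normals, x ∈ posHalfSpace e}

/-- The separation set of `T₁` and `T₂`: the indices `e ∈ E` such that `T₁` and `T₂` lie on
different sides of `H_e`. -/
def separationSet (H : HyperplaneArrangement V) (T₁ T₂ : Set V) : Set V :=
  {e | e ∈ H.normals ∧
    ((T₁ ⊆ posHalfSpace e ∧ T₂ ⊆ negHalfSpace e) ∨
      (T₁ ⊆ negHalfSpace e ∧ T₂ ⊆ posHalfSpace e))}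

/-- The sign `(-1)^T` of a chamber `T`. -/
def sign (H : HyperplaneArrangement V) (T : Set V) : ℝ :=
  (-1) ^ (H.separationSet H.baseChamber T).ncard

theorem mem_compl (H : HyperplaneArrangement V) (x : V) :
    x ∈ H.compl ↔ ∀ e ∈ H.normals, ⟪e, x⟫ ≠ 0 := by
  simp only [compl, hyperplanes, hyperplane, Set.mem_ofPred_eq]
  constructor
  · intro h e he h0
    exact h _ ⟨e, he, rfl⟩ (Submodule.mem_orthogonal_singleton_iff_inner_right.2 h0)
  · rintro h _ ⟨e, he, rfl⟩ hx
    exact h e he (Submodule.mem_orthogonal_singleton_iff_inner_right.1 hx)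

/-- The chamber of `x` consists of the points on the same side as `x` of every hyperplane. -/
theorem connectedComponentIn_compl (H : HyperplaneArrangement V) {x : V} (hx : x ∈ H.compl) :
    connectedComponentIn H.compl x = {y | ∀ e ∈ H.normals, 0 < ⟪e, x⟫ * ⟪e, y⟫} := by
  have hx' := (H.mem_compl x).1 hx
  apply Set.Subset.antisymm
  · intro y hy e he
    have hsub := connectedComponentIn_subset H.compl x
    have hpre : IsPreconnected (connectedComponentIn H.compl x) :=
      isPreconnected_connectedComponentIn
    have hxm := mem_connectedComponentIn hx
    have hcont : ContinuousOn (fun z : V => ⟪e, x⟫ * ⟪e, z⟫) (connectedComponentIn H.compl x) := by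
      fun_prop
    by_contra hneg
    have hxp : 0 < ⟪e, x⟫ * ⟪e, x⟫ := mul_self_pos.2 (hx' e he)
    obtain ⟨z, hz, hz0⟩ := hpre.intermediate_value hy hxm hcont ⟨not_lt.1 hneg, hxp.le⟩
    rcases mul_eq_zero.1 hz0 with h | h
    · exact hx' e he h
    · exact (H.mem_compl z).1 (hsub hz) e he h
  · apply IsPreconnected.subset_connectedComponentIn
    · apply Convex.isPreconnected
      intro y hy z hz a b ha hb hab e he
      have h1 := hy e he
      have h2 := hz e he
      rw [inner_add_right, inner_smul_right, inner_smul_right]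
      rcases ha.eq_or_lt with rfl | ha
      · have : b = 1 := by linarith
        subst this
        simpa using h2
      · nlinarith [mul_pos ha h1, mul_nonneg hb h2.le]
    · intro e he
      exact mul_self_pos.2 (hx' e he)
    · intro y hy
      rw [mem_compl]
      intro e he h0
      have := hy e he
      simp [h0] at this

theorem baseChamber_mem_chambers (H : HyperplaneArrangement V) :
    H.baseChamber ∈ H.chambers := by
  obtain ⟨x, hx⟩ := H.exists_pos
  have hxc : x ∈ H.compl := (H.mem_compl x).2 fun e he => (hx e he).ne'
  refine ⟨x, hxc, ?_⟩
  rw [H.connectedComponentIn_compl hxc]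
  ext y
  exact forall₂_congr fun e he => (mul_pos_iff_of_pos_left (hx e he)).symm

theorem chambers_finite (H : HyperplaneArrangement V) : H.chambers.Finite := by
  classical
  refine (H.normals.powerset.finite_toSet.image
    fun S : Finset V => {y : V | ∀ e ∈ H.normals, if e ∈ S then 0 < ⟪e, y⟫ else ⟪e, y⟫ < 0}).subset
      ?_
  rintro _ ⟨x, hx, rfl⟩
  refine ⟨H.normals.filter fun e => 0 < ⟪e, x⟫, Finset.mem_powerset.2 (Finset.filter_subset _ _), ?_⟩
  rw [H.connectedComponentIn_compl hx]
  ext y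
  refine forall₂_congr fun e he => ?_
  have h0 := (H.mem_compl x).1 hx e he
  rcases lt_or_gt_of_ne h0 with h | h
  · simp [he, h.not_gt, mul_pos_iff, h]
  · simp [he, h]

/-- The Coxeter group `W`: the group generated by the orthogonal reflections in the hyperplanes
of the arrangement. -/
def coxeterGroup (H : HyperplaneArrangement V) : Subgroup (V ≃ₗᵢ[ℝ] V) :=
  Subgroup.closure {s | ∃ e ∈ H.normals, s = (Submodule.span ℝ {e})ᗮ.reflection}

/-- The isometry `w` maps the set of hyperplanes of the arrangement onto itself. -/
def IsPreservedBy (H : HyperplaneArrangement V) (w : V ≃ₗᵢ[ℝ] V) : Prop :=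
  {L | ∃ M ∈ H.hyperplanes, L = M.map (w.toLinearEquiv : V →ₗ[ℝ] V)} = H.hyperplanes

/-- A Coxeter arrangement: the group generated by the reflections is finite and the arrangement
is closed under these reflections. -/
def IsCoxeter (H : HyperplaneArrangement V) : Prop :=
  Finite H.coxeterGroup ∧
    ∀ e ∈ H.normals, H.IsPreservedBy (Submodule.span ℝ {e})ᗮ.reflection

/-- The parity condition: `|H|` and `dim V` have the same parity. -/
def ParityCondition (H : HyperplaneArrangement V) : Prop :=
  H.card ≡ Module.finrank ℝ V [MOD 2]

/-- The pizza quantity `P(H, K) = ∑_T (-1)^T Vol(K ∩ T)` of a measurable set `K` of finite volume,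
the sum being over the (finitely many) chambers `T` of `H`. -/
def pizza [FiniteDimensional ℝ V] [MeasurableSpace V] [BorelSpace V]
    (H : HyperplaneArrangement V) (K : Set V) : ℝ :=
  ∑ T ∈ H.chambers_finite.toFinset, H.sign T * (MeasureTheory.volume (K ∩ T)).toReal

end HyperplaneArrangement

/-- The convex body `B_q(a, R) = {x : q(x - a) ≤ R²}`. -/
def quadraticBall {V : Type*} [AddCommGroup V] [Module ℝ V] (q : QuadraticForm ℝ V) (a : V)
    (R : ℝ) : Set V :=
  {x | q (x - a) ≤ R ^ 2}

end

/-! The pizza quantity of `K` is the integral over `K` of `signFun`, the product of the signs of the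
linear forms (`pizza_eq_integral`). This function is constant on open rays from the origin. If `q a
≤ R ^ 2`, the ball contains the origin and is star-shaped there, so in polar coordinates the
quantity is the integral over the unit sphere of `signFun u * ρ(u) ^ n / n`, where `n` is the
dimension and `ρ(u)` is the nonnegative root `r` of `q (r • u - a) = R ^ 2`.

This root contains a square root. The other root is the negative of the corresponding length for the
centre `-a`, and `x ↦ -x` multiplies `signFun` by `(-1) ^ |H|`, which is `(-1) ^ n` by parity.
Averaging the formulas for `a` and `-a` therefore replaces `ρ ^ n` by half the sum of the `n`-th
powers of both roots. By Vieta this is polynomial in `a` and `R ^ 2`, of degree at most `n` in `a`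
(`pizza_quadraticBall_eq`, `exists_polynomial_sphereIntegral`).

A reflection in a hyperplane of the Coxeter subarrangement preserves `q` and reverses `signFun`
(`signFun_reflection`), so the quantity vanishes when `a` lies on that hyperplane. A polynomial of
degree at most `n` vanishing on `m ≥ n` distinct hyperplanes through the origin is a multiple of the
product of their linear forms, and is zero if `m > n` (`eq_mul_prod_of_vanish_on_hyperplanes`). The
factor is read off from the part of degree `n` in `a`, in which `R` does not occur. -/

noncomputable section

/-! ### Power sums of two roots, and polynomials with prescribed roots -/

/-- The power sum `x ^ n + y ^ n` as a polynomial expression in `S = x + y` and `P = x * y`. -/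
def vietaPowerSum {A : Type*} [CommRing A] (S P : A) : ℕ → A
  | 0 => 2
  | 1 => S
  | n + 2 => S * vietaPowerSum S P (n + 1) - P * vietaPowerSum S P n

theorem vietaPowerSum_add_mul {A : Type*} [CommRing A] (x y : A) :
    ∀ n, vietaPowerSum (x + y) (x * y) n = x ^ n + y ^ n
  | 0 => by norm_num [vietaPowerSum]
  | 1 => by simp [vietaPowerSum]
  | n + 2 => by
    rw [vietaPowerSum, vietaPowerSum_add_mul x y n, vietaPowerSum_add_mul x y (n + 1)]
    ring

theorem map_vietaPowerSum {A B : Type*} [CommRing A] [CommRing B] (φ : A →+* B) (S P : A) :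
    ∀ n, φ (vietaPowerSum S P n) = vietaPowerSum (φ S) (φ P) n
  | 0 => map_ofNat φ 2
  | 1 => by simp [vietaPowerSum]
  | n + 2 => by
    simp only [vietaPowerSum, map_sub, map_mul, map_vietaPowerSum φ S P n,
      map_vietaPowerSum φ S P (n + 1)]

namespace Polynomial

theorem natDegree_vietaPowerSum_le {A : Type*} [CommRing A] {S P : A[X]}
    (hS : S.natDegree ≤ 1) (hP : P.natDegree ≤ 2) :
    ∀ n, (vietaPowerSum S P n).natDegree ≤ n
  | 0 => by simp [vietaPowerSum]
  | 1 => by simpa [vietaPowerSum] using hS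
  | n + 2 => by
    have h1 := natDegree_vietaPowerSum_le hS hP (n + 1)
    have h2 := natDegree_vietaPowerSum_le hS hP n
    rw [vietaPowerSum]
    refine (natDegree_sub_le _ _).trans (max_le ?_ ?_)
    · exact natDegree_mul_le.trans (by omega)
    · exact natDegree_mul_le.trans (by omega)

/-- The recursion is homogeneous when `S` has weight 1 and `P` weight 2, so only the top
coefficients of `S` and `P` reach degree `n`. This is why the leading coefficient will not depend on
the radius. -/
theorem coeff_vietaPowerSum {A : Type*} [CommRing A] {S P : A[X]}
    (hS : S.natDegree ≤ 1) (hP : P.natDegree ≤ 2) :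
    ∀ n, (vietaPowerSum S P n).coeff n = vietaPowerSum (S.coeff 1) (P.coeff 2) n
  | 0 => by simp [vietaPowerSum]
  | 1 => by simp [vietaPowerSum]
  | n + 2 => by
    have h1 := coeff_mul_add_eq_of_natDegree_le hS (natDegree_vietaPowerSum_le hS hP (n + 1))
    have h2 := coeff_mul_add_eq_of_natDegree_le hP (natDegree_vietaPowerSum_le hS hP n)
    rw [show 1 + (n + 1) = n + 2 by ring] at h1
    rw [add_comm 2 n] at h2
    rw [vietaPowerSum, vietaPowerSum, coeff_sub, h1, h2, coeff_vietaPowerSum hS hP n,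
      coeff_vietaPowerSum hS hP (n + 1)]

theorem continuous_coeff_mul {U : Type*} [TopologicalSpace U] {p q : U → ℝ[X]}
    (hp : ∀ k, Continuous fun u => (p u).coeff k) (hq : ∀ k, Continuous fun u => (q u).coeff k)
    (k : ℕ) : Continuous fun u => (p u * q u).coeff k := by
  simp only [coeff_mul]
  exact continuous_finsetSum _ fun i _ => (hp _).mul (hq _)

theorem continuous_coeff_vietaPowerSum {U : Type*} [TopologicalSpace U] {S P : U → ℝ[X]}
    (hS : ∀ k, Continuous fun u => (S u).coeff k) (hP : ∀ k, Continuous fun u => (P u).coeff k) :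
    ∀ n k, Continuous fun u => (vietaPowerSum (S u) (P u) n).coeff k
  | 0, k => by simpa [vietaPowerSum] using continuous_const
  | 1, k => by simpa [vietaPowerSum] using hS k
  | n + 2, k => by
    simp only [vietaPowerSum, coeff_sub]
    exact (continuous_coeff_mul hS (continuous_coeff_vietaPowerSum hS hP (n + 1)) k).sub
      (continuous_coeff_mul hP (continuous_coeff_vietaPowerSum hS hP n) k)

/-- A polynomial of degree at most `m` is determined by `m` roots and its `m`-th coefficient. -/
theorem eq_C_mul_prod_of_roots {ι : Type*} (s : Finset ι) (τ : ι → ℝ) (hτ : Set.InjOn τ s)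
    (p : ℝ[X]) (hp : p.natDegree ≤ s.card) (hroot : ∀ i ∈ s, p.eval (τ i) = 0) :
    p = C (p.coeff s.card) * ∏ i ∈ s, (X - C (τ i)) := by
  have hmonic : (∏ i ∈ s, (X - C (τ i))).Monic := monic_prod_of_monic _ _ fun i _ => monic_X_sub_C _
  have hdeg : (∏ i ∈ s, (X - C (τ i))).natDegree = s.card := by
    rw [natDegree_prod_of_monic _ _ fun i _ => monic_X_sub_C _]
    simp
  have hcoeff : (∏ i ∈ s, (X - C (τ i))).coeff s.card = 1 := by
    rw [← hdeg]
    exact hmonic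
  -- Both sides have the same coefficient at `s.card`, so their difference has degree below the
  -- number of common roots.
  refine eq_of_degree_sub_lt_of_eval_index_eq s hτ ?_ fun i hi => ?_
  · rw [degree_lt_iff_coeff_zero]
    intro k hk
    rcases hk.eq_or_lt with rfl | hk
    · simp [hcoeff]
    · rw [coeff_sub, coeff_C_mul, coeff_eq_zero_of_natDegree_lt (hp.trans_lt hk),
        coeff_eq_zero_of_natDegree_lt (hdeg.trans_lt hk)]
      simp
  · rw [hroot i hi, eval_mul, eval_prod, Finset.prod_eq_zero hi (by simp), mul_zero]

end Polynomial

/-! ### Functions that are polynomial on lines and vanish on hyperplanes -/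

section Lines

open Polynomial

variable {V : Type*} [NormedAddCommGroup V] [InnerProductSpace ℝ V]

/-- There is a vector that is orthogonal to none of finitely many nonzero vectors. -/
theorem exists_forall_inner_ne_zero {ι : Type*} [Finite ι] (d : ι → V) (hd : ∀ i, d i ≠ 0) :
    ∃ w : V, ∀ i, ⟪d i, w⟫ ≠ 0 := by
  let p : ι → Submodule ℝ V := fun i => (Submodule.span ℝ {d i})ᗮ
  obtain ⟨w, hw⟩ := Submodule.exists_forall_notMem_of_forall_ne_top p fun i h => by
    have : d i ∈ p i := h ▸ Submodule.mem_top
    rw [Submodule.mem_orthogonal_singleton_iff_inner_right] at this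
    exact hd i (inner_self_eq_zero.1 this)
  exact ⟨w, fun i h => hw i (Submodule.mem_orthogonal_singleton_iff_inner_right.2 h)⟩

/-- A function that is polynomial of degree at most `|E|` on lines and vanishes on the pairwise
distinct hyperplanes orthogonal to the elements of `E` is a multiple of the product of the linear
forms. -/
theorem eq_mul_prod_of_vanish_on_hyperplanes (E : Finset V)
    (hE : ∀ e ∈ E, ∀ f ∈ E, e ≠ f → LinearIndependent ℝ ![e, f])
    (x : V) (hx : ∀ e ∈ E, ⟪e, x⟫ ≠ 0) (g : V → ℝ) (c : V → ℝ)
    (hline : ∀ a v, ∃ p : ℝ[X], p.natDegree ≤ E.card ∧ p.coeff E.card = c v ∧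
      ∀ t, p.eval t = g (a + t • v))
    (hg : ∀ e ∈ E, ∀ a, ⟪e, a⟫ = 0 → g a = 0) (a : V) :
    g a = c x * ∏ e ∈ E, (⟪e, a⟫ / ⟪e, x⟫) := by
  classical
  -- The line `b + t • x` meets the hyperplane of `e` at `t = -⟪e, b⟫ / ⟪e, x⟫`. When these
  -- parameters are distinct they are enough roots to determine the restriction of `g`.
  have generic : ∀ b : V, (Set.InjOn (fun e => -(⟪e, b⟫ / ⟪e, x⟫)) E) →
      g b = c x * ∏ e ∈ E, (⟪e, b⟫ / ⟪e, x⟫) := by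
    intro b hb
    obtain ⟨p, hp, hpc, hpe⟩ := hline b x
    have h := p.eq_C_mul_prod_of_roots E _ hb hp fun e he => by
      rw [hpe]
      apply hg e he
      rw [inner_add_right, inner_smul_right, neg_mul, div_mul_cancel₀ _ (hx e he), add_neg_cancel]
    have h0 := congrArg (eval 0) h
    rw [hpe, zero_smul, add_zero, hpc] at h0
    simpa [eval_prod] using h0
  let ι := {i : E × E // i.1 ≠ i.2}
  -- The parameters of two normals coincide for `b` exactly when `b` is orthogonal to this vector,
  -- which is nonzero by pairwise independence.
  let d : ι → V := fun i => (⟪i.1.1.1, x⟫)⁻¹ • i.1.1.1 - (⟪i.1.2.1, x⟫)⁻¹ • i.1.2.1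
  have hd : ∀ i, d i ≠ 0 := by
    rintro ⟨⟨⟨e, he⟩, ⟨f, hf⟩⟩, hne⟩ h0
    have := LinearIndependent.pair_iff.1 (hE e he f hf fun h => hne (Subtype.ext h))
      (⟪e, x⟫)⁻¹ (-(⟪f, x⟫)⁻¹) (by simpa [d, sub_eq_add_neg] using h0)
    exact inv_ne_zero (hx e he) this.1
  obtain ⟨w, hw⟩ := exists_forall_inner_ne_zero d hd
  -- An arbitrary `a` is reached along `w`: all but finitely many points `a + t • w` are generic,
  -- and both sides are polynomial in `t`, so they also agree at `t = 0`.
  obtain ⟨p, -, -, hpe⟩ := hline a w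
  let r : ℝ[X] := C (c x) * ∏ e ∈ E, (C (⟪e, a⟫ / ⟪e, x⟫) + C (⟪e, w⟫ / ⟪e, x⟫) * X)
  have hr : ∀ t, r.eval t = c x * ∏ e ∈ E, (⟪e, a + t • w⟫ / ⟪e, x⟫) := by
    intro t
    simp only [r, eval_mul, eval_C, eval_prod, eval_add, eval_X, inner_add_right, inner_smul_right]
    congr 1
    refine Finset.prod_congr rfl fun e _ => ?_
    ring
  have hfin : (⋃ i : ι, {t : ℝ | ⟪d i, a + t • w⟫ = 0}).Finite := by
    refine Set.finite_iUnion fun i => (Set.finite_singleton (-⟪d i, a⟫ / ⟪d i, w⟫)).subset ?_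
    intro t ht
    have ht : ⟪d i, a⟫ + t * ⟪d i, w⟫ = 0 := by
      simpa only [Set.mem_ofPred_eq, inner_add_right, inner_smul_right] using ht
    rw [Set.mem_singleton_iff, eq_div_iff (hw i)]
    linarith
  have hpr : p = r := by
    refine Polynomial.eq_of_infinite_eval_eq p r (hfin.infinite_compl.mono fun t ht => ?_)
    simp only [Set.mem_compl_iff, Set.mem_iUnion, Set.mem_ofPred_eq, not_exists] at ht
    show p.eval t = r.eval t
    rw [hpe, hr]
    apply generic
    intro e he f hf hef
    by_contra hne
    refine ht ⟨⟨⟨e, he⟩, ⟨f, hf⟩⟩, fun h => hne (congrArg Subtype.val h)⟩ ?_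
    have hef : ⟪e, a + t • w⟫ / ⟪e, x⟫ = ⟪f, a + t • w⟫ / ⟪f, x⟫ := neg_injective hef
    simp only [d, inner_sub_left, real_inner_smul_left]
    rw [div_eq_inv_mul, div_eq_inv_mul] at hef
    exact sub_eq_zero.2 hef
  have := hpe 0
  rw [hpr, hr] at this
  simpa using this.symm

end Lines

/-! ### The sign function and the pizza quantity as an integral -/

namespace HyperplaneArrangement

open MeasureTheory

variable {V : Type*} [NormedAddCommGroup V] [InnerProductSpace ℝ V]

/-- The function that is `(-1)^T` on each chamber `T` and `0` on the hyperplanes. -/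
def signFun (H : HyperplaneArrangement V) (x : V) : ℝ :=
  ∏ e ∈ H.normals, Real.sign ⟪e, x⟫

theorem sign_mul_of_eq_one_or_eq_neg_one {ε : ℝ} (hε : ε = 1 ∨ ε = -1) (x : ℝ) :
    Real.sign (ε * x) = ε * Real.sign x := by
  rcases hε with rfl | rfl
  · simp
  · simp [Real.sign_neg]

theorem signFun_smul (H : HyperplaneArrangement V) {r : ℝ} (hr : 0 < r) (x : V) :
    H.signFun (r • x) = H.signFun x := by
  refine Finset.prod_congr rfl fun e _ => ?_
  rw [inner_smul_right]
  rcases lt_trichotomy ⟪e, x⟫ 0 with h | h | h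
  · rw [Real.sign_of_neg h, Real.sign_of_neg (mul_neg_of_pos_of_neg hr h)]
  · simp [h]
  · rw [Real.sign_of_pos h, Real.sign_of_pos (mul_pos hr h)]

theorem signFun_neg (H : HyperplaneArrangement V) (x : V) :
    H.signFun (-x) = (-1) ^ H.card * H.signFun x := by
  simp only [signFun, inner_neg_right, Real.sign_neg, card]
  rw [Finset.prod_neg]

theorem abs_signFun_le_one (H : HyperplaneArrangement V) (x : V) : |H.signFun x| ≤ 1 := by
  rw [signFun, Finset.abs_prod]
  refine Finset.prod_le_one (fun _ _ => abs_nonneg _) fun e _ => ?_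
  rcases Real.sign_apply_eq ⟪e, x⟫ with h | h | h <;> simp [h]

theorem signFun_of_notMem_compl (H : HyperplaneArrangement V) {x : V} (hx : x ∉ H.compl) :
    H.signFun x = 0 := by
  rw [mem_compl] at hx
  push Not at hx
  obtain ⟨e, he, h⟩ := hx
  exact Finset.prod_eq_zero he (by simp [h])

/-- The base chamber lies on the positive side of every hyperplane, so the separating normals are
those with negative inner product with `y`, each contributing a factor `-1`. -/
theorem signFun_eq_of_mem_chamber (H : HyperplaneArrangement V) {T : Set V} (hT : T ∈ H.chambers)
    {y : V} (hy : y ∈ T) : H.signFun y = H.sign T := by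
  classical
  obtain ⟨x, hx, rfl⟩ := hT
  obtain ⟨z, hz⟩ := H.exists_pos
  have hz' : z ∈ H.baseChamber := hz
  have hyc : y ∈ H.compl := connectedComponentIn_subset _ _ hy
  have hyc' := (H.mem_compl y).1 hyc
  rw [connectedComponentIn_eq hy] at *
  have hsep : H.separationSet H.baseChamber (connectedComponentIn H.compl y) =
      ↑(H.normals.filter fun e => ⟪e, y⟫ < 0) := by
    ext e
    simp only [separationSet, Set.mem_ofPred_eq, Finset.coe_filter]
    refine and_congr_right fun he => ⟨?_, fun h => Or.inl ⟨fun w hw => hw e he, fun w hw => ?_⟩⟩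
    · rintro (h | h)
      · exact h.2 (mem_connectedComponentIn hyc)
      · exact absurd (hz e he) (not_lt.2 (le_of_lt (h.1 hz')))
    · rw [H.connectedComponentIn_compl hyc] at hw
      exact (neg_iff_neg_of_mul_pos (hw e he)).1 h
  rw [sign, hsep, Set.ncard_coe_finset, signFun, ← Finset.prod_const, Finset.prod_filter]
  refine Finset.prod_congr rfl fun e he => ?_
  rcases lt_or_gt_of_ne (hyc' e he) with h | h
  · rw [Real.sign_of_neg h, if_pos h]
  · rw [Real.sign_of_pos h, if_neg h.not_gt]

theorem chambers_pairwiseDisjoint (H : HyperplaneArrangement V) :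
    H.chambers.PairwiseDisjoint id := by
  rintro _ ⟨x, hx, rfl⟩ _ ⟨y, hy, rfl⟩ hne
  refine Set.disjoint_left.2 fun z hzx hzy => hne ?_
  rw [connectedComponentIn_eq hzx, connectedComponentIn_eq hzy]

theorem biUnion_chambers (H : HyperplaneArrangement V) : ⋃ T ∈ H.chambers, T = H.compl := by
  ext x
  simp only [Set.mem_iUnion, exists_prop]
  constructor
  · rintro ⟨_, ⟨y, hy, rfl⟩, hx⟩
    exact connectedComponentIn_subset _ _ hx
  · exact fun hx => ⟨_, ⟨x, hx, rfl⟩, mem_connectedComponentIn hx⟩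

theorem isOpen_chamber (H : HyperplaneArrangement V) {T : Set V} (hT : T ∈ H.chambers) :
    IsOpen T := by
  obtain ⟨x, hx, rfl⟩ := hT
  rw [H.connectedComponentIn_compl hx]
  have : {y | ∀ e ∈ H.normals, 0 < ⟪e, x⟫ * ⟪e, y⟫} =
      ⋂ e ∈ H.normals, {y | 0 < ⟪e, x⟫ * ⟪e, y⟫} := by
    ext y
    simp
  rw [this]
  exact isOpen_biInter_finset fun e _ => isOpen_lt continuous_const (by fun_prop)

section Measure

variable [MeasurableSpace V] [BorelSpace V]

theorem measurable_realSign : Measurable Real.sign := by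
  refine Measurable.ite measurableSet_Iio measurable_const ?_
  exact Measurable.ite measurableSet_Ioi measurable_const measurable_const

theorem measurable_signFun (H : HyperplaneArrangement V) : Measurable H.signFun := by
  refine Finset.measurable_fun_prod _ fun e _ => measurable_realSign.comp ?_
  exact (continuous_const.inner continuous_id).measurable

variable [FiniteDimensional ℝ V]

theorem integrableOn_signFun (H : HyperplaneArrangement V) {K : Set V} (hK : volume K ≠ ⊤) :
    IntegrableOn H.signFun K := by
  refine Measure.integrableOn_of_bounded (M := 1) hK H.measurable_signFun.aestronglyMeasurable ?_
  exact .of_forall fun x => H.abs_signFun_le_one x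

/-- The pizza quantity is the integral of the sign function. -/
theorem pizza_eq_integral (H : HyperplaneArrangement V) {K : Set V} (hKm : MeasurableSet K)
    (hK : volume K ≠ ⊤) : H.pizza K = ∫ x in K, H.signFun x := by
  have h1 : ∫ x in K, H.signFun x = ∫ x in K ∩ H.compl, H.signFun x := by
    refine setIntegral_eq_of_subset_of_forall_sdiff_eq_zero hKm Set.inter_subset_left ?_
    intro x hx
    exact H.signFun_of_notMem_compl fun h => hx.2 ⟨hx.1, h⟩
  have h2 : K ∩ H.compl = ⋃ T ∈ H.chambers_finite.toFinset, K ∩ T := by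
    rw [← biUnion_chambers, Set.inter_iUnion₂]
    simp
  rw [h1, h2, integral_biUnion_finset, pizza]
  · refine Finset.sum_congr rfl fun T hT => ?_
    rw [Set.Finite.mem_toFinset] at hT
    rw [setIntegral_congr_fun (f := H.signFun) (g := fun _ => H.sign T) (hKm.inter (H.isOpen_chamber hT).measurableSet)
      fun y hy => H.signFun_eq_of_mem_chamber hT hy.2]
    rw [setIntegral_const, smul_eq_mul, mul_comm, measureReal_def]
  · intro T hT
    rw [Set.Finite.mem_toFinset] at hT
    exact hKm.inter (H.isOpen_chamber hT).measurableSet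
  · intro S hS T hT hne
    have hS : S ∈ H.chambers := by simpa using hS
    have hT : T ∈ H.chambers := by simpa using hT
    exact (H.chambers_pairwiseDisjoint hS hT hne).mono Set.inter_subset_right Set.inter_subset_right
  · intro T _
    exact (H.integrableOn_signFun hK).mono_set Set.inter_subset_left

end Measure

/-! ### Behaviour of the sign function under reflections -/

section Reflection

theorem reflection_apply_of_norm_eq_one {e : V} (he : ‖e‖ = 1) (x : V) :
    (Submodule.span ℝ {e})ᗮ.reflection x = x - (2 * ⟪e, x⟫) • e := by
  rw [Submodule.reflection_orthogonal_apply, Submodule.reflection_singleton_apply, he]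
  simp [two_smul, two_mul, add_smul]

theorem inner_reflection {K : Submodule ℝ V} [K.HasOrthogonalProjection] (x y : V) :
    ⟪x, K.reflection y⟫ = ⟪K.reflection x, y⟫ := by
  rw [← K.reflection.inner_map_map x, K.reflection_reflection]

theorem span_singleton_eq_of_hyperplane_eq {e f : V} (h : hyperplane e = hyperplane f) :
    Submodule.span ℝ {e} = Submodule.span ℝ {f} := by
  have := congrArg Submodule.orthogonal h
  simpa only [hyperplane, Submodule.orthogonal_orthogonal] using this

theorem eq_or_eq_neg_of_hyperplane_eq {e f : V} (he : ‖e‖ = 1) (hf : ‖f‖ = 1)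
    (h : hyperplane e = hyperplane f) : e = f ∨ e = -f := by
  have hmem : e ∈ Submodule.span ℝ {f} :=
    span_singleton_eq_of_hyperplane_eq h ▸ Submodule.mem_span_singleton_self e
  obtain ⟨c, rfl⟩ := Submodule.mem_span_singleton.1 hmem
  rw [norm_smul, hf, mul_one, Real.norm_eq_abs] at he
  rcases eq_or_eq_neg_of_abs_eq he with rfl | rfl
  · simp
  · simp

theorem map_hyperplane (w : V ≃ₗᵢ[ℝ] V) (e : V) :
    (hyperplane e).map (w.toLinearEquiv : V →ₗ[ℝ] V) = hyperplane (w e) := by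
  ext x
  simp only [hyperplane, Submodule.mem_map, Submodule.mem_orthogonal_singleton_iff_inner_right]
  constructor
  · rintro ⟨y, hy, rfl⟩
    simpa using hy
  · intro h
    refine ⟨w.symm x, ?_, by simp⟩
    rw [← w.inner_map_map]
    simpa using h

theorem eq_of_eq_or_eq_neg (H : HyperplaneArrangement V) {e f : V} (he : e ∈ H.normals)
    (hf : f ∈ H.normals) (h : e = f ∨ e = -f) : e = f := by
  by_contra hne
  have hli := LinearIndependent.pair_iff.1 (H.linearIndependent_pair e he f hf hne)
  rcases h with h | h
  · exact hne h
  · simpa using (hli 1 1 (by simp [h])).1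

/-- An isometry that preserves the arrangement permutes the normal vectors up to sign. -/
theorem IsPreservedBy.exists_normal {H : HyperplaneArrangement V} {w : V ≃ₗᵢ[ℝ] V}
    (hw : H.IsPreservedBy w) {g : V} (hg : g ∈ H.normals) :
    ∃ g' ∈ H.normals, w g = g' ∨ w g = -g' := by
  have hmem : hyperplane (w g) ∈ H.hyperplanes := by
    rw [← hw]
    exact ⟨_, ⟨g, hg, rfl⟩, (map_hyperplane w g).symm⟩
  obtain ⟨g', hg', h⟩ := hmem
  exact ⟨g', hg', eq_or_eq_neg_of_hyperplane_eq
    (by rw [w.norm_map, H.norm_eq_one g hg]) (H.norm_eq_one g' hg') h⟩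

/-- A reflection that preserves the arrangement reverses the sign function. -/
theorem signFun_reflection (H : HyperplaneArrangement V) {e : V} (he : e ∈ H.normals)
    (hp : H.IsPreservedBy (Submodule.span ℝ {e})ᗮ.reflection) (x : V) :
    H.signFun ((Submodule.span ℝ {e})ᗮ.reflection x) = -H.signFun x := by
  classical
  set s := (Submodule.span ℝ {e})ᗮ.reflection with hs
  have hss : ∀ y, s (s y) = y := (Submodule.span ℝ {e})ᗮ.reflection_reflection
  have hse : s e = -e := Submodule.reflection_orthogonalComplement_singleton_eq_neg e
  choose! π hπ hsπ using fun g (hg : g ∈ H.normals) => hp.exists_normal hg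
  have hππ : ∀ g ∈ H.normals, π (π g) = g := by
    intro g hg
    apply H.eq_of_eq_or_eq_neg (hπ _ (hπ g hg)) hg
    have h1 := hsπ _ (hπ g hg)
    rcases hsπ g hg with h | h
    · rw [← h, hss] at h1
      rcases h1 with h1 | h1
      · exact Or.inl (by rw [← h, ← h1])
      · exact Or.inr (by rw [← h, eq_neg_iff_add_eq_zero, add_comm, ← eq_neg_iff_add_eq_zero]; exact h1)
    · have h' : π g = -s g := by rw [h, neg_neg]
      rw [show s (π g) = -g by rw [h', map_neg, hss]] at h1
      rcases h1 with h1 | h1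
      · exact Or.inr h1.symm
      · exact Or.inl (neg_injective h1).symm
  have hπe : π e = e := by
    apply H.eq_of_eq_or_eq_neg (hπ e he) he
    have h := hsπ e he
    rw [hse] at h
    rcases h with h | h
    · exact Or.inr h.symm
    · exact Or.inl (neg_injective h).symm
  -- For unit vectors with `s g = ± π g` this inner product is the sign. In this form it takes the
  -- same value at `g` and `π g`, because `s` is self-adjoint.
  let ε : V → ℝ := fun g => ⟪s g, π g⟫
  have hnorm : ∀ g ∈ H.normals, ⟪g, g⟫ = 1 := fun g hg => by
    rw [real_inner_self_eq_norm_sq, H.norm_eq_one g hg, one_pow]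
  have hε : ∀ g ∈ H.normals, (ε g = 1 ∨ ε g = -1) ∧ s g = ε g • π g := by
    intro g hg
    have h1 := hnorm _ (hπ g hg)
    rcases hsπ g hg with h | h
    · have : ε g = 1 := by simp only [ε]; rw [h, h1]
      exact ⟨Or.inl this, by rw [this, one_smul, h]⟩
    · have : ε g = -1 := by simp only [ε]; rw [h, inner_neg_left, h1]
      exact ⟨Or.inr this, by rw [this, neg_one_smul, h]⟩
  have hεπ : ∀ g ∈ H.normals, ε g * ε (π g) = 1 := by
    intro g hg
    have h : ε (π g) = ε g := by
      simp only [ε]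
      rw [hππ g hg, hs, ← inner_reflection, real_inner_comm]
    rw [h]
    rcases (hε g hg).1 with h | h <;> simp [h]
  -- Normals exchanged by `π` have equal signs, which cancel. A fixed one with sign `-1` would
  -- satisfy `s g = -g` and be parallel to `e`. Hence only `e` itself contributes a `-1`.
  have hprod : ∏ g ∈ H.normals.erase e, ε g = 1 := by
    refine Finset.prod_involution (fun g _ => π g) ?_ ?_ ?_ ?_
    · exact fun g hg => hεπ g (Finset.mem_of_mem_erase hg)
    · intro g hg hne hfix
      have hg' := Finset.mem_of_mem_erase hg
      have h1 : s g = -g := by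
        have := (hε g hg').2
        rw [((hε g hg').1.resolve_left hne), hfix] at this
        simpa using this
      rw [hs, reflection_apply_of_norm_eq_one (H.norm_eq_one e he)] at h1
      have hli := LinearIndependent.pair_iff.1
        (H.linearIndependent_pair g hg' e he (Finset.ne_of_mem_erase hg)) 2 (-(2 * ⟪e, g⟫)) (by
          rw [neg_smul, ← sub_eq_add_neg, two_smul, add_sub_assoc, h1, add_neg_cancel])
      norm_num at hli
    · intro g hg
      have hg' := Finset.mem_of_mem_erase hg
      refine Finset.mem_erase.2 ⟨fun h => Finset.ne_of_mem_erase hg ?_, hπ g hg'⟩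
      rw [← hππ g hg', h, hπe]
    · exact fun g hg => hππ g (Finset.mem_of_mem_erase hg)
  have hεe : ε e = -1 := by
    simp only [ε]
    rw [hπe, hse, inner_neg_left, hnorm e he]
  calc H.signFun (s x) = ∏ g ∈ H.normals, ε g * Real.sign ⟪π g, x⟫ := by
        refine Finset.prod_congr rfl fun g hg => ?_
        rw [hs, inner_reflection, ← hs, (hε g hg).2, real_inner_smul_left,
          sign_mul_of_eq_one_or_eq_neg_one (hε g hg).1]
    _ = -H.signFun x := by
        rw [Finset.prod_mul_distrib, ← Finset.mul_prod_erase _ _ he, hprod, hεe, mul_one,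
          neg_one_mul, signFun]
        congr 1
        exact Finset.prod_bij' (fun g _ => π g) (fun g _ => π g) (fun g hg => hπ g hg)
          (fun g hg => hπ g hg) (fun g hg => hππ g hg) (fun g hg => hππ g hg) fun _ _ => rfl

end Reflection

end HyperplaneArrangement

/-! ### Polar coordinates over a star-shaped set -/

section Polar

open MeasureTheory

variable {V : Type*} [NormedAddCommGroup V] [InnerProductSpace ℝ V]
  [FiniteDimensional ℝ V] [MeasurableSpace V] [BorelSpace V]

theorem MeasureTheory.Measure.volumeIoiPow_setOf_le (n : ℕ) {ρ : ℝ} (hρ : 0 ≤ ρ) :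
    Measure.volumeIoiPow n {r | r.1 ≤ ρ} = ENNReal.ofReal (ρ ^ (n + 1) / (n + 1)) := by
  have himage : (Subtype.val '' {r : Set.Ioi (0 : ℝ) | r.1 ≤ ρ}) = Set.Ioc 0 ρ := by
    ext x
    simp [and_comm]
  rw [Measure.volumeIoiPow, withDensity_apply _ (measurableSet_le measurable_subtype_coe
    measurable_const), setLIntegral_subtype measurableSet_Ioi _ fun a : ℝ ↦ .ofReal (a ^ n),
    himage, ← ofReal_integral_eq_lintegral_ofReal (intervalIntegral.intervalIntegrable_pow _).1,
    ← intervalIntegral.integral_of_le hρ]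
  · simp
  · filter_upwards [ae_restrict_mem measurableSet_Ioc] with y hy
    exact pow_nonneg hy.1.le _

/-- Integration in polar coordinates of a function that is constant on rays over a set that is
star-shaped around the origin. -/
theorem setIntegral_eq_integral_sphere [Nontrivial V] {f : V → ℝ}
    (hf : ∀ r : ℝ, 0 < r → ∀ x, f (r • x) = f x) {K : Set V} (hKm : MeasurableSet K)
    (hint : IntegrableOn f K) {ρ : V → ℝ} (hρ : ∀ u, ‖u‖ = 1 → 0 ≤ ρ u)
    (hK : ∀ u, ‖u‖ = 1 → ∀ r : ℝ, 0 < r → (r • u ∈ K ↔ r ≤ ρ u)) :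
    ∫ x in K, f x = ∫ u : Metric.sphere (0 : V) 1,
      f u * (ρ u ^ Module.finrank ℝ V / Module.finrank ℝ V) ∂(volume : Measure V).toSphere := by
  let μ : Measure V := volume
  let Φ := homeomorphUnitSphereProd V
  let g : V → ℝ := K.indicator f
  have hg : Integrable g μ := hint.integrable_indicator hKm
  have hmp := μ.measurePreserving_homeomorphUnitSphereProd
  have hemb := Φ.measurableEmbedding
  let h : Metric.sphere (0 : V) 1 × Set.Ioi (0 : ℝ) → ℝ := fun p => g (Φ.symm p)
  have hh : ∀ x, h (Φ x) = g x := fun x => by simp [h]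
  have hhint : Integrable h (μ.toSphere.prod (.volumeIoiPow (Module.finrank ℝ V - 1))) := by
    rw [← hmp.integrable_comp_emb hemb]
    have : Integrable (fun x : ({0}ᶜ : Set V) => g x) (μ.comap (↑)) := by
      have h1 : IntegrableOn g {0}ᶜ μ := hg.integrableOn
      rw [integrableOn_iff_comap_subtypeVal (measurableSet_singleton _).compl] at h1
      exact h1
    exact this.congr (.of_forall fun x => (hh x).symm)
  have hn : 0 < Module.finrank ℝ V := Module.finrank_pos
  calc ∫ x in K, f x = ∫ x, g x ∂μ := (integral_indicator hKm).symm
    _ = ∫ x : ({0}ᶜ : Set V), g x ∂(μ.comap (↑)) := by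
      rw [integral_subtype_comap (measurableSet_singleton _).compl g,
        restrict_compl_singleton]
    _ = ∫ p, h p ∂(μ.toSphere.prod (.volumeIoiPow (Module.finrank ℝ V - 1))) := by
      rw [← hmp.integral_comp hemb]
      exact integral_congr_ae (.of_forall fun x => (hh x).symm)
    _ = ∫ u, ∫ r, h (u, r) ∂(.volumeIoiPow (Module.finrank ℝ V - 1)) ∂μ.toSphere :=
      integral_prod _ hhint
    _ = _ := by
      refine integral_congr_ae (.of_forall fun u => ?_)
      have hu : ‖(u : V)‖ = 1 := by simp
      -- In a fixed direction the integrand is the constant `f u` cut off at `ρ u`, so the radial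
      -- integral is `f u` times the measure of an interval.
      have hr : (fun r : Set.Ioi (0 : ℝ) => h (u, r)) =
          {r : Set.Ioi (0 : ℝ) | r.1 ≤ ρ u}.indicator fun _ => f u := by
        funext r
        have hr0 : (0 : ℝ) < r := r.2
        have h1 : ((Φ.symm (u, r) : ({0}ᶜ : Set V)) : V) = (r : ℝ) • (u : V) := by
          simp [Φ]
        simp only [h, g, h1]
        by_cases hle : r.1 ≤ ρ u
        · rw [Set.indicator_of_mem ((hK u hu r hr0).2 hle), hf r hr0]
          simp [hle]
        · rw [Set.indicator_of_notMem fun hm => hle ((hK u hu r hr0).1 hm)]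
          simp [hle]
      simp only [hr]
      rw [integral_indicator (measurableSet_le measurable_subtype_coe measurable_const),
        setIntegral_const, measureReal_def, Measure.volumeIoiPow_setOf_le _ (hρ u hu),
        Nat.sub_add_cancel hn, ENNReal.toReal_ofReal (by have := hρ u hu; positivity), smul_eq_mul,
        mul_comm, Nat.cast_pred hn, sub_add_cancel]

end Polar

/-! ### Positive definite forms and their balls -/

namespace QuadraticMap.PosDef

variable {V : Type*} [NormedAddCommGroup V] [InnerProductSpace ℝ V]
  [FiniteDimensional ℝ V] {q : QuadraticForm ℝ V}

theorem _root_.QuadraticForm.continuous_of_finiteDimensional (q : QuadraticForm ℝ V) :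
    Continuous q := by
  have h2 : Continuous fun x => (associated (R := ℝ) q x) x := by
    have : Continuous fun x => LinearMap.toContinuousLinearMap (associated (R := ℝ) q x) :=
      ((LinearMap.toContinuousLinearMap : (V →ₗ[ℝ] ℝ) ≃ₗ[ℝ] _).toLinearMap ∘ₗ
        (associated (R := ℝ) q)).continuous_of_finiteDimensional
    exact this.clm_apply continuous_id
  exact h2.congr fun x => associated_eq_self_apply ℝ q x

/-- The minimum of `q` on the unit sphere is positive, and by homogeneity it bounds `q x` below by a
multiple of `‖x‖ ^ 2`. -/
theorem isCompact_setOf_le (hq : q.PosDef) (s : ℝ) : IsCompact {x | q x ≤ s} := by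
  have hc := q.continuous_of_finiteDimensional
  refine Metric.isCompact_of_isClosed_isBounded (isClosed_le hc continuous_const) ?_
  rcases subsingleton_or_nontrivial V with hV | hV
  · exact (Set.toFinite _).isBounded
  obtain ⟨u, hu, hmin⟩ := (isCompact_sphere (0 : V) 1).exists_isMinOn
    (NormedSpace.sphere_nonempty.2 zero_le_one) hc.continuousOn
  have hu1 : ‖u‖ = 1 := by simpa using hu
  have hu0 : 0 < q u := hq u fun h => by simp [h] at hu1
  have hbound : ∀ x, q u * ‖x‖ ^ 2 ≤ q x := by
    intro x
    rcases eq_or_ne x 0 with rfl | hx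
    · simp
    have hx' : ‖x‖ ≠ 0 := norm_ne_zero_iff.2 hx
    have h1 : q u ≤ q (‖x‖⁻¹ • x) := hmin (by simp [norm_smul, hx'])
    rw [QuadraticMap.map_smul, smul_eq_mul] at h1
    calc q u * ‖x‖ ^ 2 ≤ (‖x‖⁻¹ * ‖x‖⁻¹ * q x) * ‖x‖ ^ 2 := by gcongr
      _ = q x := by field_simp
  refine (Metric.isBounded_closedBall (x := (0 : V)) (r := √(s / q u))).subset fun x hx => ?_
  rw [mem_closedBall_zero_iff]
  apply Real.le_sqrt_of_sq_le
  rw [le_div_iff₀ hu0, mul_comm]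
  exact (hbound x).trans hx

theorem isCompact_quadraticBall (hq : q.PosDef) (a : V) (R : ℝ) :
    IsCompact (quadraticBall q a R) := by
  have := (Homeomorph.subRight a).isCompact_preimage.2 (hq.isCompact_setOf_le (R ^ 2))
  exact this

end QuadraticMap.PosDef

/-! ### Intersection of a ray with a quadratic ball -/

section QuadraticForm

open QuadraticMap

variable {V : Type*} [NormedAddCommGroup V] [InnerProductSpace ℝ V] {q : QuadraticForm ℝ V}

theorem QuadraticForm.map_smul_sub (q : QuadraticForm ℝ V) (r : ℝ) (u a : V) :
    q (r • u - a) = q u * r ^ 2 - polar q u a * r + q a := by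
  rw [sub_eq_add_neg, QuadraticMap.map_add q, QuadraticMap.polar_neg_right,
    QuadraticMap.polar_smul_left, QuadraticMap.map_smul, QuadraticMap.map_neg]
  simp only [smul_eq_mul]
  ring

theorem QuadraticForm.map_add_smul (q : QuadraticForm ℝ V) (t : ℝ) (a v : V) :
    q (a + t • v) = q a + polar q a v * t + q v * t ^ 2 := by
  rw [QuadraticMap.map_add q, QuadraticMap.polar_smul_right, QuadraticMap.map_smul]
  simp only [smul_eq_mul]
  ring

/-- An isometry that preserves the unit ball of a positive definite quadratic form preserves the
form. -/
theorem QuadraticMap.PosDef.map_eq_of_image_quadraticBall (hq : q.PosDef) (w : V ≃ₗᵢ[ℝ] V)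
    (h : w '' quadraticBall q 0 1 = quadraticBall q 0 1) (x : V) : q (w x) = q x := by
  have hiff : ∀ y, q (w y) ≤ 1 ↔ q y ≤ 1 := by
    intro y
    have h1 : w y ∈ w '' quadraticBall q 0 1 ↔ y ∈ quadraticBall q 0 1 :=
      w.injective.mem_set_image
    rw [h] at h1
    simpa [quadraticBall] using h1
  -- Rescaling by `√m` turns invariance of the unit ball into invariance of every positive sublevel
  -- set; these determine the nonnegative function `q`.
  have hscale : ∀ m : ℝ, 0 < m → (q (w x) ≤ m ↔ q x ≤ m) := by
    intro m hm
    have h1 := hiff ((√m)⁻¹ • x)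
    rw [map_smul, QuadraticMap.map_smul, QuadraticMap.map_smul, ← mul_inv,
      Real.mul_self_sqrt hm.le, smul_eq_mul, smul_eq_mul, inv_mul_le_iff₀ hm, inv_mul_le_iff₀ hm,
      mul_one] at h1
    exact h1
  apply le_antisymm
  · refine le_of_forall_gt_imp_ge_of_dense fun m hm => ?_
    exact (hscale m ((hq.nonneg x).trans_lt hm)).2 hm.le
  · refine le_of_forall_gt_imp_ge_of_dense fun m hm => ?_
    exact (hscale m ((hq.nonneg (w x)).trans_lt hm)).1 hm.le

theorem QuadraticForm.continuous_polar_left [FiniteDimensional ℝ V] (q : QuadraticForm ℝ V)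
    (a : V) : Continuous fun u => polar q u a := by
  have := q.continuous_of_finiteDimensional
  exact ((this.comp (continuous_id.add continuous_const)).sub this).sub continuous_const

/-- The larger root `r` of `q (r • u - a) = s`. -/
def rayLength (q : QuadraticForm ℝ V) (a : V) (s : ℝ) (u : V) : ℝ :=
  (polar q u a + √(polar q u a ^ 2 + 4 * q u * (s - q a))) / (2 * q u)

variable {a u : V} {s : ℝ}

theorem rayLength_nonneg (hu : 0 < q u) (hs : q a ≤ s) : 0 ≤ rayLength q a s u := by
  have h1 : |polar q u a| ≤ √(polar q u a ^ 2 + 4 * q u * (s - q a)) := by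
    apply Real.abs_le_sqrt
    have := mul_nonneg hu.le (sub_nonneg.2 hs)
    linarith
  have := neg_abs_le (polar q u a)
  exact div_nonneg (by linarith) (by linarith)

/-- Changing `(r, a)` to `(-r, -a)` preserves `q (r • u - a) = s`, so the second root is `-rayLength
q (-a) s u`. This lemma and the next are Vieta's formulas for the two roots. -/
theorem rayLength_sub_rayLength_neg (hu : 0 < q u) :
    rayLength q a s u + -rayLength q (-a) s u = polar q u a / q u := by
  simp only [rayLength, QuadraticMap.polar_neg_right, QuadraticMap.map_neg, neg_sq]
  field_simp
  ring

theorem rayLength_mul_neg_rayLength_neg (hu : 0 < q u) (hs : q a ≤ s) :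
    rayLength q a s u * -rayLength q (-a) s u = (q a - s) / q u := by
  simp only [rayLength, QuadraticMap.polar_neg_right, QuadraticMap.map_neg, neg_sq]
  have h := mul_nonneg hu.le (sub_nonneg.2 hs)
  have := Real.sq_sqrt (show 0 ≤ polar q u a ^ 2 + 4 * q u * (s - q a) by positivity)
  field_simp
  linear_combination -this

/-- Factor the quadratic in `r` over its two roots: the factor of the nonpositive root is positive
for `r > 0`, so the other one decides the sign. -/
theorem map_smul_sub_le_iff_le_rayLength (hu : 0 < q u) (hs : q a ≤ s) {r : ℝ} (hr : 0 < r) :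
    q (r • u - a) ≤ s ↔ r ≤ rayLength q a s u := by
  have h1 := rayLength_sub_rayLength_neg (q := q) (a := a) (s := s) hu
  have h2 := rayLength_mul_neg_rayLength_neg hu hs
  have h3 : 0 ≤ rayLength q (-a) s u := rayLength_nonneg hu (by rwa [QuadraticMap.map_neg])
  rw [eq_div_iff hu.ne'] at h1 h2
  have h4 : q (r • u - a) - s =
      q u * (r + rayLength q (-a) s u) * (r - rayLength q a s u) := by
    rw [q.map_smul_sub]
    linear_combination r * h1 - h2
  have h5 : 0 < q u * (r + rayLength q (-a) s u) := by positivity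
  rw [← sub_nonpos, h4, mul_nonpos_iff_pos_imp_nonpos]
  constructor
  · intro h
    linarith [h.1 h5]
  · intro h
    exact ⟨fun _ => by linarith, fun _ => h5.le⟩

theorem continuous_rayLength [FiniteDimensional ℝ V] (hq : q.PosDef) (a : V) (s : ℝ) :
    Continuous fun u : Metric.sphere (0 : V) 1 => rayLength q a s u := by
  have h1 := (q.continuous_polar_left a).comp
    (continuous_subtype_val (p := fun x => x ∈ Metric.sphere (0 : V) 1))
  have h2 := q.continuous_of_finiteDimensional.comp
    (continuous_subtype_val (p := fun x => x ∈ Metric.sphere (0 : V) 1))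
  refine Continuous.div (h1.add ?_) (continuous_const.mul h2) fun u => ?_
  · exact ((h1.pow 2).add ((continuous_const.mul h2).mul continuous_const)).sqrt
  · exact mul_ne_zero two_ne_zero (hq u (ne_zero_of_mem_unit_sphere u)).ne'

end QuadraticForm

/-! ### Polynomiality and vanishing of the pizza quantity -/

namespace HyperplaneArrangement

open MeasureTheory QuadraticMap Polynomial

variable {V : Type*} [NormedAddCommGroup V] [InnerProductSpace ℝ V]
  [FiniteDimensional ℝ V] [MeasurableSpace V] [BorelSpace V]
  (H : HyperplaneArrangement V) {q : QuadraticForm ℝ V}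

/-- The integral over the unit sphere that computes the pizza quantity of `𝔹_q(a, R)` for
`s = R²`, and depends polynomially on `a` and `s`. -/
def sphereIntegral (q : QuadraticForm ℝ V) (a : V) (s : ℝ) : ℝ :=
  ∫ u : Metric.sphere (0 : V) 1, H.signFun u *
    vietaPowerSum (polar q u a / q u) ((q a - s) / q u) (Module.finrank ℝ V)
    ∂(volume : Measure V).toSphere

theorem integrable_signFun_mul {c : Metric.sphere (0 : V) 1 → ℝ} (hc : Continuous c) :
    Integrable (fun u : Metric.sphere (0 : V) 1 => H.signFun u * c u)
      (volume : Measure V).toSphere := by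
  have hci : Integrable c (volume : Measure V).toSphere :=
    hc.integrable_of_hasCompactSupport (HasCompactSupport.of_compactSpace c)
  exact hci.bdd_mul (c := 1)
    (H.measurable_signFun.comp measurable_subtype_coe).aestronglyMeasurable
    (.of_forall fun u => H.abs_signFun_le_one u)

theorem setIntegral_preimage_isometry (w : V ≃ₗᵢ[ℝ] V) (K : Set V) (f : V → ℝ) :
    ∫ x in w ⁻¹' K, f (w x) = ∫ x in K, f x :=
  w.measurePreserving.setIntegral_preimage_emb w.toHomeomorph.measurableEmbedding f K

theorem integral_quadraticBall_neg (a : V) (R : ℝ) :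
    ∫ x in quadraticBall q (-a) R, H.signFun x =
      (-1) ^ H.card * ∫ x in quadraticBall q a R, H.signFun x := by
  rw [← setIntegral_preimage_isometry (LinearIsometryEquiv.neg ℝ), ← integral_const_mul]
  have : (LinearIsometryEquiv.neg ℝ : V ≃ₗᵢ[ℝ] V) ⁻¹' quadraticBall q (-a) R =
      quadraticBall q a R := by
    ext x
    simp only [quadraticBall, Set.mem_preimage, Set.mem_ofPred_eq, LinearIsometryEquiv.coe_neg]
    rw [← neg_sub', QuadraticMap.map_neg]
  rw [this]
  exact integral_congr_ae (.of_forall fun x => H.signFun_neg x)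

theorem integral_quadraticBall_eq [Nontrivial V] (hq : q.PosDef) {a : V} {R : ℝ}
    (ha : q a ≤ R ^ 2) :
    ∫ x in quadraticBall q a R, H.signFun x = ∫ u : Metric.sphere (0 : V) 1,
      H.signFun u * (rayLength q a (R ^ 2) u ^ Module.finrank ℝ V / Module.finrank ℝ V)
        ∂(volume : Measure V).toSphere := by
  have hpos : ∀ u : V, ‖u‖ = 1 → 0 < q u := fun u hu => hq u fun h => by simp [h] at hu
  have hc := hq.isCompact_quadraticBall a R
  exact setIntegral_eq_integral_sphere (fun r hr x => H.signFun_smul hr x)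
    hc.measurableSet (H.integrableOn_signFun hc.measure_ne_top)
    (fun u hu => rayLength_nonneg (hpos u hu) ha)
    fun u hu r hr => map_smul_sub_le_iff_le_rayLength (hpos u hu) ha hr

/-- Parity makes the contributions of `a` and `-a` combine into the sum of `n`-th powers of both
roots, which removes the square root. -/
theorem pizza_quadraticBall_eq [Nontrivial V] (hpar : H.ParityCondition) (hq : q.PosDef) {a : V}
    {R : ℝ} (ha : q a ≤ R ^ 2) :
    H.pizza (quadraticBall q a R) =
      (2 * Module.finrank ℝ V : ℝ)⁻¹ * H.sphereIntegral q a (R ^ 2) := by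
  have hc := hq.isCompact_quadraticBall a R
  rw [H.pizza_eq_integral hc.measurableSet hc.measure_ne_top]
  set n := Module.finrank ℝ V with hn
  have hn0 : (n : ℝ) ≠ 0 := Nat.cast_ne_zero.2 Module.finrank_pos.ne'
  have hsign : ((-1) ^ H.card : ℝ) = (-1) ^ n := by
    rw [neg_one_pow_eq_pow_mod_two, hpar, ← neg_one_pow_eq_pow_mod_two]
  have h1 := H.integral_quadraticBall_eq hq ha
  have h2 := H.integral_quadraticBall_eq hq (a := -a) (R := R) (by rwa [QuadraticMap.map_neg])
  rw [integral_quadraticBall_neg, hsign] at h2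
  have hsq : ((-1) ^ n * (-1) ^ n : ℝ) = 1 := by rw [← mul_pow]; simp
  -- The inner `(-1) ^ n` turns the second integral into that of the ball around `-a`; the outer one
  -- is the sign in `(-rayLength q (-a) s u) ^ n`.
  have key : H.sphereIntegral q a (R ^ 2) =
      n * (∫ x in quadraticBall q a R, H.signFun x) +
        n * ((-1) ^ n * ((-1) ^ n * ∫ x in quadraticBall q a R, H.signFun x)) := by
    rw [h2, h1, ← integral_const_mul, ← integral_const_mul, ← integral_const_mul,
      ← integral_add]
    · refine integral_congr_ae (.of_forall fun u => ?_)
      have hu : 0 < q u := hq u (ne_zero_of_mem_unit_sphere u)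
      simp only
      rw [← rayLength_sub_rayLength_neg (s := R ^ 2) hu, ← rayLength_mul_neg_rayLength_neg hu ha,
        vietaPowerSum_add_mul, ← hn, neg_pow (rayLength q (-a) _ _)]
      field_simp
    · exact (H.integrable_signFun_mul (((continuous_rayLength hq a _).pow n).div_const _)).const_mul _
    · exact ((H.integrable_signFun_mul
        (((continuous_rayLength hq (-a) _).pow n).div_const _)).const_mul _).const_mul _
  rw [key, ← mul_assoc ((-1) ^ n) _ (∫ x in quadraticBall q a R, H.signFun x), hsq]
  field_simp
  ring

/-- The sphere integral is polynomial on lines. -/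
theorem exists_polynomial_sphereIntegral (hq : q.PosDef) (s : ℝ) (a v : V) :
    ∃ p : ℝ[X], p.natDegree ≤ Module.finrank ℝ V ∧
      p.coeff (Module.finrank ℝ V) = H.sphereIntegral q v 0 ∧
      ∀ t, p.eval t = H.sphereIntegral q (a + t • v) s := by
  set n := Module.finrank ℝ V with hn
  -- `S u` and `P u` are the sum and product of the roots for the centre `a + t • v`, as polynomials
  -- in `t`. The level `s` enters only the constant term of `P u`.
  let S : Metric.sphere (0 : V) 1 → ℝ[X] := fun u =>
    C (polar q u a / q u) + C (polar q u v / q u) * X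
  let P : Metric.sphere (0 : V) 1 → ℝ[X] := fun u =>
    C ((q a - s) / q u) + C (polar q a v / q u) * X + C (q v / q u) * X ^ 2
  have hqc : Continuous fun u : Metric.sphere (0 : V) 1 => q u :=
    q.continuous_of_finiteDimensional.comp continuous_subtype_val
  have hq0 : ∀ u : Metric.sphere (0 : V) 1, q u ≠ 0 := fun u =>
    (hq u (ne_zero_of_mem_unit_sphere u)).ne'
  have hpc : ∀ b, Continuous fun u : Metric.sphere (0 : V) 1 => polar q u b := fun b =>
    (q.continuous_polar_left b).comp continuous_subtype_val
  have hSc : ∀ k, Continuous fun u => (S u).coeff k := by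
    intro k
    simp only [S, coeff_add, coeff_C_mul, coeff_C]
    refine Continuous.add ?_ (((hpc v).div hqc hq0).mul continuous_const)
    split_ifs
    exacts [(hpc a).div hqc hq0, continuous_const]
  have hPc : ∀ k, Continuous fun u => (P u).coeff k := by
    intro k
    simp only [P, coeff_add, coeff_C_mul, coeff_C]
    refine Continuous.add (Continuous.add ?_ ?_) ?_
    · split_ifs
      exacts [continuous_const.div hqc hq0, continuous_const]
    · exact (continuous_const.div hqc hq0).mul continuous_const
    · exact (continuous_const.div hqc hq0).mul continuous_const
  have hSd : ∀ u, (S u).natDegree ≤ 1 := fun u => by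
    simp only [S]
    compute_degree
  have hPd : ∀ u, (P u).natDegree ≤ 2 := fun u => by
    simp only [P]
    compute_degree
  let c : ℕ → ℝ := fun k => ∫ u : Metric.sphere (0 : V) 1,
    H.signFun u * (vietaPowerSum (S u) (P u) n).coeff k ∂(volume : Measure V).toSphere
  refine ⟨∑ k ∈ Finset.range (n + 1), monomial k (c k), ?_, ?_, fun t => ?_⟩
  · refine natDegree_sum_le_of_forall_le _ _ fun k hk => (natDegree_monomial_le _).trans ?_
    exact Nat.lt_succ_iff.1 (Finset.mem_range.1 hk)
  · rw [finsetSum_coeff]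
    simp only [coeff_monomial]
    rw [Finset.sum_ite_eq' (Finset.range (n + 1)) n, if_pos (by simp)]
    refine integral_congr_ae (.of_forall fun u => ?_)
    simp only [coeff_vietaPowerSum (hSd u) (hPd u)]
    simp [S, P, coeff_C, coeff_X_pow, hn]
  · simp only [eval_finsetSum, eval_monomial, c, sphereIntegral, ← integral_mul_const]
    rw [← integral_finsetSum]
    · refine integral_congr_ae (.of_forall fun u => ?_)
      have h1 : (S u).eval t = polar q u (a + t • v) / q u := by
        simp only [S, eval_add, eval_mul, eval_C, eval_X, polar_add_right, polar_smul_right,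
          smul_eq_mul]
        ring
      have h2 : (P u).eval t = (q (a + t • v) - s) / q u := by
        simp only [P, eval_add, eval_mul, eval_C, eval_X, eval_pow, q.map_add_smul]
        ring
      have h3 := map_vietaPowerSum (evalRingHom t) (S u) (P u) n
      simp only [coe_evalRingHom, h1, h2] at h3
      simp only [← hn, mul_assoc, ← Finset.mul_sum]
      rw [← h3, eval_eq_sum_range' (Nat.lt_succ_of_le (natDegree_vietaPowerSum_le (hSd u) (hPd u) n))]
    · intro k _
      exact (H.integrable_signFun_mul
        (continuous_coeff_vietaPowerSum hSc hPc n k)).mul_const _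

/-- The pizza quantity vanishes if the center lies on the hyperplane of a reflection that
preserves both the arrangement and the quadratic form. -/
theorem pizza_quadraticBall_eq_zero_of_inner_eq_zero (hq : q.PosDef) {e : V} (he : e ∈ H.normals)
    (hp : H.IsPreservedBy (Submodule.span ℝ {e})ᗮ.reflection)
    (hinv : ∀ x, q ((Submodule.span ℝ {e})ᗮ.reflection x) = q x) {a : V} (ha : ⟪e, a⟫ = 0)
    (R : ℝ) : H.pizza (quadraticBall q a R) = 0 := by
  have hc := hq.isCompact_quadraticBall a R
  rw [H.pizza_eq_integral hc.measurableSet hc.measure_ne_top]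
  set w := (Submodule.span ℝ {e})ᗮ.reflection
  have hwa : w a = a := Submodule.reflection_mem_subspace_eq_self
    (Submodule.mem_orthogonal_singleton_iff_inner_right.2 ha)
  have hpre : w ⁻¹' quadraticBall q a R = quadraticBall q a R := by
    ext x
    simp only [quadraticBall, Set.mem_preimage, Set.mem_ofPred_eq]
    rw [← hinv (x - a), map_sub w, hwa]
  have h := setIntegral_preimage_isometry w (quadraticBall q a R) H.signFun
  rw [hpre, integral_congr_ae (.of_forall fun x => H.signFun_reflection he hp x),
    integral_neg] at h
  linarith

/-- The comparison with the pizza quantity needs the origin in the ball, hence holds for `t • a`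
with `t` small. Polynomiality in `t` carries the vanishing to `t = 1`, so `a` is not restricted in
size. -/
theorem sphereIntegral_eq_zero_of_inner_eq_zero [Nontrivial V] (hpar : H.ParityCondition)
    (hq : q.PosDef) {e : V} (he : e ∈ H.normals)
    (hp : H.IsPreservedBy (Submodule.span ℝ {e})ᗮ.reflection)
    (hinv : ∀ x, q ((Submodule.span ℝ {e})ᗮ.reflection x) = q x) {R : ℝ} (hR : R ≠ 0)
    {a : V} (ha : ⟪e, a⟫ = 0) : H.sphereIntegral q a (R ^ 2) = 0 := by
  have hn : (2 * Module.finrank ℝ V : ℝ)⁻¹ ≠ 0 :=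
    inv_ne_zero (mul_ne_zero two_ne_zero (Nat.cast_ne_zero.2 Module.finrank_pos.ne'))
  obtain ⟨p, -, -, hpe⟩ := H.exists_polynomial_sphereIntegral hq (R ^ 2) 0 a
  have hev : ∀ᶠ t in nhds (0 : ℝ), q (t • a) < R ^ 2 := by
    have hcont : Continuous fun t : ℝ => q (t • a) :=
      q.continuous_of_finiteDimensional.comp (continuous_id.smul continuous_const)
    refine (hcont.tendsto 0).eventually_lt_const ?_
    simpa using pow_pos (abs_pos.2 hR) 2
  have hp0 : p = 0 := by
    refine p.eq_zero_of_infinite_isRoot ((infinite_of_mem_nhds 0 hev).mono fun t ht => ?_)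
    have h1 := H.pizza_quadraticBall_eq hpar hq (le_of_lt ht)
    rw [H.pizza_quadraticBall_eq_zero_of_inner_eq_zero hq he hp hinv
      (by rw [inner_smul_right, ha, mul_zero])] at h1
    have h2 := (mul_eq_zero.1 h1.symm).resolve_left hn
    simp only [Set.mem_ofPred_eq, IsRoot, hpe, zero_add, h2]
  have := hpe 1
  rw [hp0, eval_zero, one_smul, zero_add] at this
  exact this.symm

/-- The pizza quantity of a ball that contains the origin is a multiple of the product of the
linear forms of the Coxeter subarrangement. -/
theorem pizza_quadraticBall_eq_mul_prod [Nontrivial V] (hpar : H.ParityCondition)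
    (hq : q.PosDef) (E : Finset V) (hE : E ⊆ H.normals)
    (hp : ∀ e ∈ E, H.IsPreservedBy (Submodule.span ℝ {e})ᗮ.reflection)
    (hinv : ∀ e ∈ E, ∀ x, q ((Submodule.span ℝ {e})ᗮ.reflection x) = q x)
    (hcard : Module.finrank ℝ V ≤ E.card) :
    ∃ c : ℝ, (Module.finrank ℝ V < E.card → c = 0) ∧ ∀ (R : ℝ) (a : V), q a ≤ R ^ 2 →
      H.pizza (quadraticBall q a R) = c * ∏ e ∈ E, ⟪a, e⟫ := by
  classical
  obtain ⟨x, hx⟩ := H.exists_pos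
  have hx0 : ∀ e ∈ E, ⟪e, x⟫ ≠ 0 := fun e he => (hx e (hE he)).ne'
  have hn : 0 < Module.finrank ℝ V := Module.finrank_pos
  -- The coefficient at `E.card` on lines of direction `v`: the degree is at most the dimension, so
  -- it is zero if `E` is larger. It is the same for all `R`.
  let lead : V → ℝ := fun v =>
    if E.card = Module.finrank ℝ V then H.sphereIntegral q v 0 else 0
  refine ⟨(2 * Module.finrank ℝ V : ℝ)⁻¹ * (lead x * ∏ e ∈ E, (⟪e, x⟫)⁻¹), fun h => ?_,
    fun R a ha => ?_⟩
  · simp [lead, h.ne']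
  -- For `R = 0` there is no room for small `t • a`. Then `a = 0`, and both sides vanish since `E`
  -- is nonempty.
  rcases eq_or_ne R 0 with rfl | hR
  · have ha0 : a = 0 := by
      by_contra hne
      have := hq a hne
      norm_num at ha
      linarith
    obtain ⟨e, he⟩ := Finset.card_pos.1 (hn.trans_le hcard)
    rw [H.pizza_quadraticBall_eq_zero_of_inner_eq_zero hq (hE he) (hp e he) (hinv e he)
      (by rw [ha0, inner_zero_right]), Finset.prod_eq_zero (f := fun e => ⟪a, e⟫) he (by rw [ha0, inner_zero_left]),
      mul_zero]
  · have key := eq_mul_prod_of_vanish_on_hyperplanes E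
      (fun e he f hf => H.linearIndependent_pair e (hE he) f (hE hf)) x hx0
      (fun b => H.sphereIntegral q b (R ^ 2)) lead (fun b v => ?_)
      (fun e he b hb => H.sphereIntegral_eq_zero_of_inner_eq_zero hpar hq (hE he) (hp e he)
        (hinv e he) hR hb) a
    · rw [H.pizza_quadraticBall_eq hpar hq ha, key, mul_assoc, mul_assoc,
        ← Finset.prod_mul_distrib]
      congr 2
      refine Finset.prod_congr rfl fun e _ => ?_
      rw [div_eq_inv_mul, real_inner_comm a e]
    · obtain ⟨p, hpd, hpc, hpe⟩ := H.exists_polynomial_sphereIntegral hq (R ^ 2) b v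
      refine ⟨p, hpd.trans hcard, ?_, hpe⟩
      by_cases h : E.card = Module.finrank ℝ V
      · rw [h, hpc]
        simp only [lead, if_pos h]
      · simp only [lead, if_neg h]
        exact coeff_eq_zero_of_natDegree_lt (hpd.trans_lt (lt_of_le_of_ne hcard (Ne.symm h)))

end HyperplaneArrangement

end

/-! ### The main theorem -/

theorem corollary7p3 {V : Type*} [NormedAddCommGroup V] [InnerProductSpace ℝ V]
    [FiniteDimensional ℝ V] [MeasurableSpace V] [BorelSpace V]
    (q : QuadraticForm ℝ V) (hq : q.PosDef)
    (H : HyperplaneArrangement V) (hpar : H.ParityCondition)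
    (H' : HyperplaneArrangement V) (hsub : H'.normals ⊆ H.normals) (hcox : H'.IsCoxeter)
    (hH : ∀ w ∈ H'.coxeterGroup, H.IsPreservedBy w)
    (hball : ∀ w ∈ H'.coxeterGroup, w '' quadraticBall q 0 1 = quadraticBall q 0 1) :
    (Module.finrank ℝ V < H'.card →
      ∀ (R : ℝ) (a : V), q a ≤ R ^ 2 → H.pizza (quadraticBall q a R) = 0) ∧
    (H'.card = Module.finrank ℝ V →
      (∃ c : ℝ, ∀ (R : ℝ) (a : V), q a ≤ R ^ 2 →
        H.pizza (quadraticBall q a R) = c * ∏ e ∈ H'.normals, ⟪a, e⟫) ∧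
      (∀ (R₁ R₂ : ℝ) (a : V), q a ≤ R₁ ^ 2 → q a ≤ R₂ ^ 2 →
        H.pizza (quadraticBall q a R₁) = H.pizza (quadraticBall q a R₂))) := by
  have hmem : ∀ e ∈ H'.normals, (Submodule.span ℝ {e})ᗮ.reflection ∈ H'.coxeterGroup :=
    fun e he => Subgroup.subset_closure ⟨e, he, rfl⟩
  have main : Module.finrank ℝ V ≤ H'.card → ∃ c : ℝ, (Module.finrank ℝ V < H'.card → c = 0) ∧
      ∀ (R : ℝ) (a : V), q a ≤ R ^ 2 →
        H.pizza (quadraticBall q a R) = c * ∏ e ∈ H'.normals, ⟪a, e⟫ := by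
    intro hcard
    -- In dimension zero polar coordinates are not available. There are no normals, the product is
    -- empty, and every ball considered is the whole space.
    rcases subsingleton_or_nontrivial V with hV | hV
    · have hempty : H'.normals = ∅ := by
        refine Finset.eq_empty_of_forall_notMem fun e he => ?_
        have := H'.norm_eq_one e he
        simp [Subsingleton.elim e 0] at this
      refine ⟨H.pizza Set.univ, fun h => ?_, fun R a ha => ?_⟩
      · simp [HyperplaneArrangement.card, hempty] at h
      · have huniv : quadraticBall q a R = Set.univ := by
          refine Set.eq_univ_of_forall fun x => ?_
          show q (x - a) ≤ R ^ 2
          rwa [Subsingleton.elim (x - a) a]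
        rw [huniv, hempty, Finset.prod_empty, mul_one]
    · exact H.pizza_quadraticBall_eq_mul_prod hpar hq H'.normals hsub
        (fun e he => hH _ (hmem e he))
        (fun e he => hq.map_eq_of_image_quadraticBall _ (hball _ (hmem e he))) hcard
  refine ⟨fun hlt R a ha => ?_, fun heq => ?_⟩
  · obtain ⟨c, hc, h⟩ := main hlt.le
    rw [h R a ha, hc hlt, zero_mul]
  · obtain ⟨c, -, h⟩ := main heq.ge
    exact ⟨⟨c, h⟩, fun R₁ R₂ a h₁ h₂ => by rw [h R₁ a h₁, h R₂ a h₂]⟩
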